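/- All graphs are finite, simple and have at least one vertex. A graph is \emph{traceable} if it has a Hamilton path (a path containing all its vertices). A graph is \emph{$S$-free} if it has no induced subgraph isomorphic to $S$. For an integer $r$, a graph $G$ on $n$ vertices is \emph{claw-$o_r$-heavy} if every induced subgraph of $G$ isomorphic to the claw $K_{1,3}$ contains two distinct nonadjacent vertices whose degree sum in $G$ is at least $n+r$. Let $C_3$ be the triangle, $P_i$ the path on $i$ vertices, and $Z_1$ the graph obtained from a triangle by adding one new vertex joined to exactly one vertex of the triangle. \textbf{Theorem.} Let $r\ge 0$ be an integer and let $S$ be a connected graph with at least three vertices that is not isomorphic to $P_3$. Then the following are equivalent: (i) every connected, claw-$o_r$-heavy, $S$-free graph $G$ is traceable; (ii) $S$ is isomorphic to $C_3$, $Z_1$ or $P_4$. -/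

import Mathlib

/-- A graph is traceable if it contains a Hamilton path. -/
def SimpleGraph.Traceable {V : Type*} (G : SimpleGraph V) : Prop :=
  open Classical in ∃ (u v : V) (p : G.Walk u v), p.IsHamiltonian

/-- `G` is `H`-free: `G` has no induced subgraph isomorphic to `H`. -/
def SimpleGraph.InducedFree {W V : Type*} (H : SimpleGraph W) (G : SimpleGraph V) : Prop :=
  ¬ H.IsIndContained G

/-- The subgraph of `G` induced by `X` is `o_r`-heavy: there are two (distinct) nonadjacent
vertices in `X` whose degree sum in `G` is at least `n + r`, where `n` is the order of `G`. -/
def SimpleGraph.IsOHeavyOn {V : Type*} [Fintype V] (G : SimpleGraph V) (r : ℤ) (X : Set V) :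
    Prop :=
  open Classical in
  ∃ u ∈ X, ∃ v ∈ X, u ≠ v ∧ ¬ G.Adj u v ∧
    (Fintype.card V : ℤ) + r ≤ (G.degree u : ℤ) + (G.degree v : ℤ)

/-- `G` is `H`-`o_r`-heavy: every induced subgraph of `G` isomorphic to `H` is `o_r`-heavy. -/
def SimpleGraph.IsOHeavy {W V : Type*} [Fintype V] (H : SimpleGraph W) (r : ℤ)
    (G : SimpleGraph V) : Prop :=
  ∀ X : Set V, Nonempty (H ≃g G.induce X) → G.IsOHeavyOn r X

/-- The claw `K_{1,3}`. -/
abbrev clawGraph : SimpleGraph (Fin 1 ⊕ Fin 3) := completeBipartiteGraph (Fin 1) (Fin 3)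

/-- The graph `Z_1`: a triangle `0, 1, 2` with one pendant edge, joining `3` to the vertex `0`
of the triangle. -/
def graphZ1 : SimpleGraph (Fin 4) :=
  SimpleGraph.fromEdgeSet {s(0, 1), s(1, 2), s(0, 2), s(0, 3)}

/-! Sufficiency goes by closure. If `G` is not traceable, take a maximal nontraceable graph `H ≥ G`
on the same vertices. Nonadjacent vertices of `H` have degree sum at most n - 2
(`degree_add_degree_le_of_maximal`), so every claw of `G` has two leaves adjacent in `H`. If `H` has
a universal vertex, a longest path yields three pairwise nonadjacent vertices
(`exists_three_nonadj_of_not_traceable`), and it remains to rule these out.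

A connected noncomplete P_4-free graph is a join. The vertices of its smaller side have degree at
least n/2, so they are universal in `H`, and the three vertices form a claw of `G` centred on that
side. A triangle-free counterexample has adjacent vertices of degree exactly n/2, whose
neighbourhoods are a bipartition of `G`; heaviness makes `G` almost complete bipartite, and in `H`
both classes become cliques. A connected Z_1-free graph is triangle-free or complete multipartite,
hence P_4-free.

For necessity, `S` must embed in two nontraceable graphs: the claw-free net, and a large clique
joined to three vertices with pendant edges. The second contains no bull, and the connected induced
subgraphs of the net without a bull, on at least three vertices, are P_3, C_3, Z_1 and P_4. -/

namespace SimpleGraph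

/-! ### Longest paths as vertex lists -/

section PathLists

variable {V : Type*} {G : SimpleGraph V}

/-- A list of vertices that traverses a path of `G`. -/
def IsPathList (G : SimpleGraph V) (l : List V) : Prop := l.Nodup ∧ l.IsChain G.Adj

theorem traceable_iff_exists_isPathList [Nonempty V] :
    G.Traceable ↔ ∃ l, G.IsPathList l ∧ ∀ v, v ∈ l := by
  classical
  constructor
  · rintro ⟨u, v, p, hp⟩
    refine ⟨p.support, ⟨?_, p.isChain_adj_support⟩, fun w => ?_⟩
    · exact List.nodup_iff_count_eq_one.2 fun a _ => by convert hp a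
    · refine List.count_pos_iff.1 ?_
      have h := hp w
      have h' : p.support.count w = 1 := by convert h
      omega
  · rintro ⟨l, ⟨hn, hc⟩, hl⟩
    have hne : l ≠ [] := List.ne_nil_of_mem (hl (Classical.arbitrary V))
    refine ⟨_, _, Walk.ofSupport l hne hc, fun a => ?_⟩
    rw [Walk.support_ofSupport]
    exact List.count_eq_one_of_mem hn (hl a)

/-- A list of vertices traversing a path of maximum order. -/
def IsLongestPathList (G : SimpleGraph V) (l : List V) : Prop :=
  G.IsPathList l ∧ ∀ l', G.IsPathList l' → l'.length ≤ l.length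

theorem exists_isLongestPathList [Finite V] (G : SimpleGraph V) :
    ∃ l, G.IsLongestPathList l := by
  have := Fintype.ofFinite V
  let s : Set ℕ := {k | ∃ l, G.IsPathList l ∧ l.length = k}
  have hs : s.Nonempty := ⟨0, [], ⟨List.nodup_nil, List.isChain_nil⟩, rfl⟩
  have hb : BddAbove s := ⟨Fintype.card V, by
    rintro _ ⟨l, hl, rfl⟩
    exact hl.1.length_le_card⟩
  obtain ⟨l, hl, hk⟩ := Nat.sSup_mem hs hb
  exact ⟨l, hl, fun l' hl' => hk ▸ le_csSup hb ⟨l', hl', rfl⟩⟩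

theorem IsLongestPathList.not_isPathList_of_length_lt {l l' : List V}
    (h : G.IsLongestPathList l) (hlt : l.length < l'.length) : ¬ G.IsPathList l' :=
  fun h' => absurd (h.2 l' h') (not_le.2 hlt)

/-- A vertex on a longest path that has a neighbour off the path is an inner vertex of the path,
and the first vertex of the path, the successor of the vertex and the neighbour are pairwise
nonadjacent. -/
theorem IsLongestPathList.exists_of_adj {l : List V} (h : G.IsLongestPathList l) {v x : V}
    (hv : v ∈ l) (hx : x ∉ l) (hvx : G.Adj v x) :
    ∃ (a : V) (l₁ : List V) (s : V) (l₂ : List V), l = (a :: l₁) ++ v :: s :: l₂ ∧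
      ¬ G.Adj a x ∧ ¬ G.Adj x s ∧ ¬ G.Adj a s := by
  obtain ⟨l₁, l₂, rfl⟩ := List.append_of_mem hv
  have hlp := h.1
  obtain ⟨hnd, hch⟩ := h.1
  rcases l₁ with _ | ⟨a, l₁⟩
  · refine absurd ?_ (h.not_isPathList_of_length_lt (l' := x :: v :: l₂) (by simp))
    exact ⟨List.nodup_cons.2 ⟨hx, hnd⟩, List.isChain_cons_cons.2 ⟨hvx.symm, hch⟩⟩
  rcases l₂ with _ | ⟨s, l₂⟩
  · refine absurd ?_ (h.not_isPathList_of_length_lt (l' := (a :: l₁) ++ [v] ++ [x]) (by simp))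
    refine ⟨List.nodup_append.2 ⟨hnd, by simp, ?_⟩, List.isChain_append.2 ⟨hch, by simp, ?_⟩⟩
    · rintro b hb c hc rfl
      exact hx (by rw [List.mem_singleton.1 hc] at hb; exact hb)
    · rw [List.getLast?_concat]
      simpa using hvx
  rw [List.isChain_append] at hch
  obtain ⟨hc₁, hc₂, hc₃⟩ := hch
  rw [List.isChain_cons_cons] at hc₂
  refine ⟨a, l₁, s, l₂, rfl, fun hax => ?_, fun hxs => ?_, fun has => ?_⟩
  · refine h.not_isPathList_of_length_lt (l' := x :: ((a :: l₁) ++ v :: s :: l₂)) (by simp) ?_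
    exact ⟨List.nodup_cons.2 ⟨hx, hnd⟩, List.isChain_cons_cons.2 ⟨hax.symm, hlp.2⟩⟩
  · refine h.not_isPathList_of_length_lt (l' := (a :: l₁) ++ v :: x :: s :: l₂) (by simp) ?_
    refine ⟨?_, ?_⟩
    · have : ((a :: l₁) ++ v :: x :: s :: l₂).Perm (x :: ((a :: l₁) ++ v :: s :: l₂)) := by
        have := (List.perm_middle (a := x) (l₁ := (a :: l₁) ++ [v]) (l₂ := s :: l₂))
        simpa using this
      exact this.nodup_iff.2 (List.nodup_cons.2 ⟨hx, hnd⟩)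
    · refine List.isChain_append.2 ⟨hc₁, ?_, by simpa using hc₃⟩
      exact List.isChain_cons_cons.2 ⟨hvx, List.isChain_cons_cons.2 ⟨hxs, hc₂.2⟩⟩
  -- The rerouted path goes from `x` to `v`, back along the path to `a`, then by the edge `as` to
  -- the rest.
  · refine h.not_isPathList_of_length_lt
      (l' := x :: v :: ((a :: l₁).reverse ++ s :: l₂)) (by simp) ?_
    refine ⟨?_, ?_⟩
    · have : (x :: v :: ((a :: l₁).reverse ++ s :: l₂)).Perm
          (x :: ((a :: l₁) ++ v :: s :: l₂)) := by
        refine List.Perm.cons _ (List.Perm.trans ?_ List.perm_middle.symm)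
        exact List.Perm.cons _ (List.Perm.append_right _ (List.reverse_perm _))
      exact this.nodup_iff.2 (List.nodup_cons.2 ⟨hx, hnd⟩)
    · rw [List.isChain_cons_cons]
      refine ⟨hvx.symm, List.IsChain.cons ?_ ?_⟩
      · refine List.isChain_append.2
          ⟨List.isChain_reverse.2 (hc₁.imp fun _ _ h => h.symm), hc₂.2, ?_⟩
        simpa using has
      · intro y hy
        refine (hc₃ y ?_ v (by simp)).symm
        rw [List.head?_append_of_ne_nil _ (by simp), List.head?_reverse] at hy
        exact hy

/-- A graph with a universal vertex and no three pairwise nonadjacent vertices is traceable. -/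
theorem exists_three_nonadj_of_not_traceable [Finite V] (hG : ¬ G.Traceable) {v : V}
    (hv : ∀ w, w ≠ v → G.Adj v w) :
    ∃ a b c, a ≠ b ∧ a ≠ c ∧ b ≠ c ∧ ¬ G.Adj a b ∧ ¬ G.Adj a c ∧ ¬ G.Adj b c := by
  have : Nonempty V := ⟨v⟩
  obtain ⟨l, hl⟩ := G.exists_isLongestPathList
  obtain ⟨x, hx⟩ : ∃ x, x ∉ l := by
    by_contra! h
    exact hG (traceable_iff_exists_isPathList.2 ⟨l, hl.1, h⟩)
  have hvl : v ∈ l := by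
    by_contra hvl
    refine hl.not_isPathList_of_length_lt (l' := v :: l) (by simp) ?_
    refine ⟨List.nodup_cons.2 ⟨hvl, hl.1.1⟩, List.IsChain.cons hl.1.2 fun y hy => hv y ?_⟩
    rintro rfl
    exact hvl (List.mem_of_mem_head? hy)
  obtain ⟨a, l₁, s, l₂, rfl, h₁, h₂, h₃⟩ := hl.exists_of_adj hvl hx
    (hv x fun h => hx (h ▸ hvl))
  have hn := hl.1.1
  refine ⟨a, x, s, ?_, ?_, ?_, h₁, h₃, h₂⟩
  · rintro rfl; simp at hx
  · rintro rfl; simp at hn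
  · rintro rfl; simp at hx

end PathLists

/-! ### The Ore and Bondy–Chvátal degree bound -/

section Ore

variable {V : Type*} {G : SimpleGraph V}

/-- Each of the `L.length` consecutive pairs is charged at most once, for `A` at its second entry or
`B` at its first; the last entry does not count for `B`. -/
theorem countP_add_countP_le_of_isChain {α : Type*} (A B : α → Bool) (a : α) (L : List α)
    (hch : (a :: L).IsChain fun x y => ¬ (A y ∧ B x))
    (hlast : ∀ x ∈ (a :: L).getLast?, ¬ B x) :
    L.countP A + (a :: L).countP B ≤ L.length := by
  induction L generalizing a with
  | nil => simpa using hlast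
  | cons b L ih =>
    rw [List.isChain_cons_cons] at hch
    have := ih b hch.2 (by simpa [List.getLast?_cons_cons] using hlast)
    rw [List.countP_cons (a := b) (p := A), List.countP_cons (a := a) (p := B)]
    have h := hch.1
    simp only [List.length_cons]
    split_ifs <;> first | omega | (exfalso; apply h; constructor <;> assumption)

open scoped Classical in
/-- If joining the paths `u :: L` and `v :: M` does not make `G` traceable, then `u` and `v`
have few neighbours on `u :: L`. -/
theorem countP_adj_add_countP_adj_le [Nonempty V] (hG : ¬ G.Traceable) {u v : V} {L M : List V}
    (hX : (u :: L).IsChain G.Adj) (hY : (v :: M).IsChain G.Adj)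
    (hn : ((u :: L) ++ (v :: M)).Nodup) (hall : ∀ w, w ∈ (u :: L) ++ (v :: M)) :
    (u :: L).countP (G.Adj u) + (u :: L).countP (G.Adj v) ≤ L.length := by
  have key := countP_add_countP_le_of_isChain (fun w => decide (G.Adj u w))
    (fun w => decide (G.Adj v w)) u L ?_ ?_
  · have h0 : (u :: L).countP (fun w => decide (G.Adj u w)) =
        L.countP (fun w => decide (G.Adj u w)) := List.countP_cons_of_neg (by simp)
    rw [h0]; exact key
  · rw [List.isChain_iff_forall_rel_of_append_cons_cons]
    rintro a b p q hpq ⟨hub, hva⟩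
    simp only [decide_eq_true_eq] at hub hva
    apply hG
    rw [traceable_iff_exists_isPathList]
    -- With consecutive `a`, `b` on the first path, `b` adjacent to `u` and `a` to `v`, a Hamilton
    -- path runs from the far end back to `b`, jumps to `u`, follows the path to `a`, and jumps to
    -- `v`.
    have hperm : (q.reverse ++ b :: (p ++ [a]) ++ v :: M).Perm ((u :: L) ++ (v :: M)) := by
      rw [hpq]
      refine List.Perm.append_right _ ?_
      refine List.perm_middle.trans ?_
      have h2 : (p ++ a :: b :: q).Perm (b :: ((p ++ [a]) ++ q)) := by
        have := List.perm_middle (a := b) (l₁ := p ++ [a]) (l₂ := q)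
        simpa using this
      refine List.Perm.trans (List.Perm.cons _ ?_) h2.symm
      exact (List.Perm.append_right _ (List.reverse_perm q)).trans List.perm_append_comm
    refine ⟨_, ⟨hperm.nodup_iff.2 hn, ?_⟩, fun w => hperm.mem_iff.2 (hall w)⟩
    rw [hpq] at hX
    have e : p ++ a :: b :: q = (p ++ [a]) ++ (b :: q) := by simp
    rw [e, List.isChain_append] at hX
    have hr : (q.reverse ++ [b]).IsChain G.Adj := by
      have := List.isChain_reverse.2 (hX.2.1.imp fun _ _ h => h.symm)
      simpa using this
    have hh : (p ++ [a]).head? = some u := by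
      have := congrArg List.head? hpq
      rw [e, List.head?_append_of_ne_nil _ (by simp)] at this
      simpa using this.symm
    rw [List.isChain_append]
    refine ⟨?_, hY, by simpa [List.getLast?_append, List.getLast?_cons] using hva.symm⟩
    have e2 : q.reverse ++ b :: (p ++ [a]) = (q.reverse ++ [b]) ++ (p ++ [a]) := by simp
    rw [e2, List.isChain_append]
    refine ⟨hr, hX.1, ?_⟩
    rw [hh]
    simpa using hub.symm
  · intro x hx hvx
    simp only [decide_eq_true_eq] at hvx
    refine hG (traceable_iff_exists_isPathList.2
      ⟨(u :: L) ++ (v :: M), ⟨hn, List.isChain_append.2 ⟨hX, hY, ?_⟩⟩, hall⟩)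
    intro y hy z hz
    obtain rfl : y = x := Option.some_injective _ (hy.symm.trans hx)
    obtain rfl : v = z := by simpa using hz
    exact hvx.symm

open scoped Classical in
theorem degree_eq_countP [Fintype V] {l : List V} (hn : l.Nodup) (hall : ∀ w, w ∈ l) (u : V) :
    G.degree u = l.countP (G.Adj u) := by
  rw [List.countP_eq_length_filter, ← List.toFinset_card_of_nodup (hn.filter _),
    ← card_neighborFinset_eq_degree]
  congr 1
  ext w
  simp [hall]

open scoped Classical in
theorem degree_add_degree_le_of_two_paths [Fintype V] [Nonempty V] (hG : ¬ G.Traceable) {u v : V}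
    {L M : List V} (hX : (u :: L).IsChain G.Adj) (hY : (v :: M).IsChain G.Adj)
    (hn : ((u :: L) ++ (v :: M)).Nodup) (hall : ∀ w, w ∈ (u :: L) ++ (v :: M)) :
    G.degree u + G.degree v + 2 ≤ Fintype.card V := by
  have h₁ := countP_adj_add_countP_adj_le hG hX hY hn hall
  have h₂ := countP_adj_add_countP_adj_le hG hY hX (List.perm_append_comm.nodup_iff.1 hn)
    fun w => List.perm_append_comm.mem_iff.1 (hall w)
  have hc : Fintype.card V = ((u :: L) ++ (v :: M)).length := by
    rw [← List.toFinset_card_of_nodup hn, ← Finset.card_univ]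
    congr 1
    ext w
    exact iff_of_true (Finset.mem_univ _) (List.mem_toFinset.2 (hall w))
  rw [degree_eq_countP hn hall u, degree_eq_countP hn hall v, hc]
  simp only [List.countP_append, List.length_append, List.length_cons] at *
  omega

open scoped Classical in
/-- Ore's condition for traceability, in the form of Bondy and Chvátal. -/
theorem degree_add_degree_le_of_maximal [Fintype V] {u v : V} (huv : u ≠ v)
    (hG : Maximal (fun H : SimpleGraph V => ¬ H.Traceable) G) (hadj : ¬ G.Adj u v) :
    G.degree u + G.degree v + 2 ≤ Fintype.card V := by
  have : Nonempty V := ⟨u⟩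
  have hT : (G ⊔ edge u v).Traceable := by
    by_contra h
    have := hG.2 h le_sup_left
    exact hadj (this (Or.inr (by simp [edge_adj, huv])))
  obtain ⟨l, ⟨hn, hc⟩, hall⟩ := traceable_iff_exists_isPathList.1 hT
  have hnc : ¬ l.IsChain G.Adj := fun h =>
    hG.1 (traceable_iff_exists_isPathList.2 ⟨l, ⟨hn, h⟩, hall⟩)
  rw [List.isChain_iff_forall_rel_of_append_cons_cons] at hnc
  push Not at hnc
  obtain ⟨a, b, l₁, l₂, rfl, hab⟩ := hnc
  have e : l₁ ++ a :: b :: l₂ = (l₁ ++ [a]) ++ (b :: l₂) := by simp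
  rw [e] at hn hc hall
  rw [List.isChain_append] at hc
  obtain ⟨hc₁, hc₂, hc₃⟩ := hc
  -- A step of the path that is not an edge of `G` must be the added edge; cutting there leaves two
  -- paths of `G`, since neither half contains both `a` and `b`.
  have hedge : s(a, b) = s(u, v) := by
    have := hc₃ a (by simp) b (by simp)
    rw [sup_adj, edge_adj] at this
    rcases this with h | ⟨h, _⟩
    · exact absurd h hab
    · rw [Sym2.eq_iff]; simpa [eq_comm, and_comm] using h
  have hmono : ∀ l' : List V, (a ∉ l' ∨ b ∉ l') → l'.IsChain (G ⊔ edge u v).Adj →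
      l'.IsChain G.Adj := by
    intro l' h hl'
    rw [List.isChain_iff_forall_rel_of_append_cons_cons] at hl' ⊢
    intro c d p q hpq
    rcases hl' hpq with h' | h'
    · exact h'
    · exfalso
      have hcd : s(c, d) = s(a, b) := by
        rw [hedge]
        rw [edge_adj] at h'
        rw [Sym2.eq_iff]; simpa [eq_comm, and_comm] using h'.1
      have hcm : c ∈ l' := by simp [hpq]
      have hdm : d ∈ l' := by simp [hpq]
      rw [Sym2.eq_iff] at hcd
      rcases hcd with ⟨rfl, rfl⟩ | ⟨rfl, rfl⟩ <;> tauto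
  have hd := List.disjoint_of_nodup_append hn
  have hc₁' := hmono _ (Or.inr fun h => hd h (by simp)) hc₁
  have hc₂' := hmono _ (Or.inl fun h => hd (by simp) h) hc₂
  have hr : (a :: l₁.reverse).IsChain G.Adj := by
    have := List.isChain_reverse.2 (hc₁'.imp fun _ _ h => h.symm)
    simpa using this
  have hperm : ((l₁ ++ [a]) ++ (b :: l₂)).Perm ((a :: l₁.reverse) ++ (b :: l₂)) := by
    refine List.Perm.append_right _ ?_
    have := (List.reverse_perm (l₁ ++ [a])).symm
    simpa using this
  have key := degree_add_degree_le_of_two_paths hG.1 hr hc₂' (hperm.nodup_iff.1 hn)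
    fun w => hperm.mem_iff.1 (hall w)
  rw [Sym2.eq_iff] at hedge
  rcases hedge with ⟨rfl, rfl⟩ | ⟨rfl, rfl⟩ <;> omega

theorem exists_maximal_not_traceable [Finite V] (hG : ¬ G.Traceable) :
    ∃ H, G ≤ H ∧ Maximal (fun H : SimpleGraph V => ¬ H.Traceable) H :=
  (Set.toFinite {H : SimpleGraph V | ¬ H.Traceable}).exists_le_maximal hG

end Ore

/-! ### Heavy claws in terms of centre and leaves -/

section ClawHeavy

variable {V : Type*} {G : SimpleGraph V}

theorem Embedding.nonempty_iso_of_range_eq {W V' : Type*} {S : SimpleGraph W}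
    {H : SimpleGraph V'} (f : S ↪g G) (g : H ↪g G) (h : Set.range f = Set.range g) :
    Nonempty (S ≃g H) := by
  let e : W ≃ V' := (Equiv.ofInjective f f.injective).trans
    ((Equiv.setCongr h).trans (Equiv.ofInjective g g.injective).symm)
  have he : ∀ w, g (e w) = f w := fun w => by
    have := Equiv.apply_ofInjective_symm g.injective (Equiv.setCongr h ⟨f w, w, rfl⟩)
    simpa [e] using this
  refine ⟨⟨e, ?_⟩⟩
  intro a b
  rw [← g.map_adj_iff, ← f.map_adj_iff, he, he]

/-- An embedding as an isomorphism onto the subgraph induced by its range. -/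
theorem Embedding.nonempty_iso_induce_range {W : Type*} {S : SimpleGraph W} (f : S ↪g G) :
    Nonempty (S ≃g G.induce (Set.range f)) :=
  f.nonempty_iso_of_range_eq (Embedding.induce _) (by ext; simp [Embedding.induce])

open scoped Classical in
theorem IsOHeavy.claw [Fintype V] {r : ℤ} (h : clawGraph.IsOHeavy r G) {c x y z : V}
    (hcx : G.Adj c x) (hcy : G.Adj c y) (hcz : G.Adj c z) (hxy : x ≠ y) (hxz : x ≠ z)
    (hyz : y ≠ z) (axy : ¬ G.Adj x y) (axz : ¬ G.Adj x z) (ayz : ¬ G.Adj y z) :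
    (Fintype.card V : ℤ) + r ≤ G.degree x + G.degree y ∨
      (Fintype.card V : ℤ) + r ≤ G.degree x + G.degree z ∨
      (Fintype.card V : ℤ) + r ≤ G.degree y + G.degree z := by
  let f : Fin 1 ⊕ Fin 3 → V := Sum.elim (fun _ => c) ![x, y, z]
  have hinj : Function.Injective f := by
    have h1 := hcx.ne; have h2 := hcy.ne; have h3 := hcz.ne
    rintro (i | i) (j | j) hij <;> fin_cases i <;> fin_cases j <;> simp_all [f]
  have hadj : ∀ i j, G.Adj (f i) (f j) ↔ clawGraph.Adj i j := by
    have h1 := hcx.symm; have h2 := hcy.symm; have h3 := hcz.symm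
    have h4 : ¬ G.Adj y x := fun h => axy h.symm
    have h5 : ¬ G.Adj z x := fun h => axz h.symm
    have h6 : ¬ G.Adj z y := fun h => ayz h.symm
    rintro (i | i) (j | j) <;> fin_cases i <;> fin_cases j <;> simp_all [f]
  let e : clawGraph ↪g G := ⟨⟨f, hinj⟩, fun {i j} => hadj i j⟩
  obtain ⟨_, ⟨i, rfl⟩, _, ⟨j, rfl⟩, hne, hna, hd⟩ := h (Set.range e) e.nonempty_iso_induce_range
  let D : V → ℤ := fun v => G.degree v
  have hd' : (Fintype.card V : ℤ) + r ≤ D (f i) + D (f j) := hd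
  change (Fintype.card V : ℤ) + r ≤ D x + D y ∨ (Fintype.card V : ℤ) + r ≤ D x + D z ∨
    (Fintype.card V : ℤ) + r ≤ D y + D z
  have hne' : f i ≠ f j := hne
  have hna' : ¬ clawGraph.Adj i j := fun h => hna ((hadj i j).2 h)
  clear hd hne hna
  clear_value D
  rcases i with i | i <;> rcases j with j | j <;> fin_cases i <;> fin_cases j <;>
    simp_all [f] <;> omega

open scoped Classical in
/-- Every claw contains two leaves whose degree sum is at least the order of the graph. -/
def ClawHeavy [Fintype V] (G : SimpleGraph V) : Prop :=
  ∀ ⦃c x y z : V⦄, G.Adj c x → G.Adj c y → G.Adj c z → x ≠ y → x ≠ z → y ≠ z →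
    ¬ G.Adj x y → ¬ G.Adj x z → ¬ G.Adj y z →
    Fintype.card V ≤ G.degree x + G.degree y ∨ Fintype.card V ≤ G.degree x + G.degree z ∨
      Fintype.card V ≤ G.degree y + G.degree z

theorem IsOHeavy.clawHeavy [Fintype V] {r : ℤ} (h : clawGraph.IsOHeavy r G) (hr : 0 ≤ r) :
    G.ClawHeavy := by
  intro c x y z h₁ h₂ h₃ h₄ h₅ h₆ h₇ h₈ h₉
  have := h.claw h₁ h₂ h₃ h₄ h₅ h₆ h₇ h₈ h₉
  omega

end ClawHeavy

/-! ### Passing to a maximal nontraceable supergraph -/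

section Maximal

variable {V : Type*} [Fintype V] {G H : SimpleGraph V}

-- Degrees only grow from `G` to `H`. The threshold n - 1, rather than n, is needed in the
-- triangle-free case, for degrees m and m - 1 with n = 2m.
open scoped Classical in
theorem adj_of_maximal (hGH : G ≤ H) (hH : Maximal (fun H : SimpleGraph V => ¬ H.Traceable) H)
    {u v : V} (huv : u ≠ v) (hd : Fintype.card V ≤ G.degree u + G.degree v + 1) : H.Adj u v := by
  by_contra h
  have := degree_add_degree_le_of_maximal huv hH h
  have h₁ : G.degree u ≤ H.degree u := degree_le_of_le hGH
  have h₂ : G.degree v ≤ H.degree v := degree_le_of_le hGH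
  omega

/-- A claw of a claw-heavy graph is not induced in the closure. -/
theorem ClawHeavy.not_of_maximal (hG : G.ClawHeavy) (hGH : G ≤ H)
    (hH : Maximal (fun H : SimpleGraph V => ¬ H.Traceable) H) {c x y z : V}
    (hcx : G.Adj c x) (hcy : G.Adj c y) (hcz : G.Adj c z) (hxy : x ≠ y) (hxz : x ≠ z)
    (hyz : y ≠ z) (axy : ¬ H.Adj x y) (axz : ¬ H.Adj x z) (ayz : ¬ H.Adj y z) : False := by
  rcases hG hcx hcy hcz hxy hxz hyz (fun h => axy (hGH h)) (fun h => axz (hGH h))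
    (fun h => ayz (hGH h)) with h | h | h
  · exact axy (adj_of_maximal hGH hH hxy (by omega))
  · exact axz (adj_of_maximal hGH hH hxz (by omega))
  · exact ayz (adj_of_maximal hGH hH hyz (by omega))

-- Vertices of `T` have degree at least n/2, so `T` is universal in `H`. Three pairwise nonadjacent
-- vertices of `H` thus avoid `T` and are leaves of a claw of `G` centred in `T`.
open scoped Classical in
theorem traceable_of_join (hG : G.ClawHeavy) {T : Finset V} (hT : T.Nonempty)
    (hcard : 2 * T.card ≤ Fintype.card V) (hjoin : ∀ t ∈ T, ∀ w, w ∉ T → G.Adj t w) :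
    G.Traceable := by
  by_contra hnt
  obtain ⟨H, hGH, hH⟩ := exists_maximal_not_traceable hnt
  have hdeg : ∀ t ∈ T, Fintype.card V ≤ 2 * G.degree t := by
    intro t ht
    have hsub : Tᶜ ⊆ G.neighborFinset t := fun w hw => by
      simpa using hjoin t ht w (Finset.mem_compl.1 hw)
    have := Finset.card_le_card hsub
    rw [Finset.card_compl, card_neighborFinset_eq_degree] at this
    omega
  have huniv : ∀ t ∈ T, ∀ w, w ≠ t → H.Adj t w := by
    intro t ht w hwt
    by_cases hw : w ∈ T
    · refine adj_of_maximal hGH hH hwt.symm ?_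
      have := hdeg t ht
      have := hdeg w hw
      omega
    · exact hGH (hjoin t ht w hw)
  obtain ⟨t, ht⟩ := hT
  obtain ⟨a, b, c, hab, hac, hbc, nab, nac, nbc⟩ :=
    exists_three_nonadj_of_not_traceable hH.1 (huniv t ht)
  have ha : a ∉ T := fun h => nab (huniv a h b hab.symm)
  have hb : b ∉ T := fun h => nbc (huniv b h c hbc.symm)
  have hc : c ∉ T := fun h => nac (huniv c h a hac).symm
  exact hG.not_of_maximal hGH hH (hjoin t ht a ha) (hjoin t ht b hb) (hjoin t ht c hc)
    hab hac hbc nab nac nbc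

end Maximal

/-! ### Graphs without an induced P_4 -/

section PathFour

variable {V : Type*} {G : SimpleGraph V}

/-- `G` has no induced path on four vertices. -/
def PathFourFree (G : SimpleGraph V) : Prop :=
  ∀ ⦃a b c d : V⦄, G.Adj a b → G.Adj b c → G.Adj c d → ¬ G.Adj a c → ¬ G.Adj a d →
    ¬ G.Adj b d → False

theorem Connected.exists_boundary_adj (hG : G.Connected) {s : Set V} {a b : V} (ha : a ∈ s)
    (hb : b ∉ s) : ∃ x ∈ s, ∃ y ∉ s, G.Adj x y := by
  obtain ⟨p⟩ := hG.preconnected a b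
  obtain ⟨d, -, h₁, h₂⟩ := p.exists_boundary_dart s ha hb
  exact ⟨_, h₁, _, h₂, d.adj⟩

/-- Two disjoint nonempty sets of vertices without edges between them. -/
def Separated (G : SimpleGraph V) (A B : Finset V) : Prop :=
  A.Nonempty ∧ B.Nonempty ∧ Disjoint A B ∧ ∀ a ∈ A, ∀ b ∈ B, ¬ G.Adj a b

theorem Separated.symm {A B : Finset V} (h : G.Separated A B) : G.Separated B A :=
  ⟨h.2.1, h.1, h.2.2.1.symm, fun b hb a ha hba => h.2.2.2 a ha b hb hba.symm⟩

/-- By maximality `t` has a neighbour `b` in `B`. If `t` missed some vertex of `A`, moving `t` and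
its neighbours in `A` over to `B` would give a larger separated pair: an edge `xy` between a
non-neighbour and a neighbour of `t` in `A` would make `x y t b` an induced P_4. -/
theorem PathFourFree.adj_of_separated (hP : G.PathFourFree) {A B : Finset V}
    (h : G.Separated A B)
    (hmax : ∀ A' B', G.Separated A' B' → A'.card + B'.card ≤ A.card + B.card) {t : V}
    (htA : t ∉ A) (htB : t ∉ B) : ∀ a ∈ A, G.Adj t a := by
  classical
  obtain ⟨hA, hB, hdis, hno⟩ := h
  obtain ⟨b, hb, htb⟩ : ∃ b ∈ B, G.Adj t b := by
    by_contra! hcon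
    have := hmax (insert t A) B ⟨Finset.insert_nonempty _ _, hB,
      Finset.disjoint_insert_left.2 ⟨htB, hdis⟩, fun a ha b hb => by
        rcases Finset.mem_insert.1 ha with rfl | ha
        · exact hcon b hb
        · exact hno a ha b hb⟩
    rw [Finset.card_insert_of_notMem htA] at this
    omega
  intro a ha
  by_contra hta
  have hdis' : ∀ x ∈ A, x ∉ B := fun _ hx => Finset.disjoint_left.1 hdis hx
  have hsep : G.Separated (A.filter fun x => ¬ G.Adj t x)
      (insert t (B ∪ A.filter fun x => G.Adj t x)) := by
    refine ⟨⟨a, by simp [ha, hta]⟩, Finset.insert_nonempty _ _, ?_, ?_⟩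
    · rw [Finset.disjoint_left]
      intro x hx hx'
      rw [Finset.mem_filter] at hx
      simp only [Finset.mem_insert, Finset.mem_union, Finset.mem_filter] at hx'
      rcases hx' with rfl | hx' | hx'
      · exact htA hx.1
      · exact hdis' x hx.1 hx'
      · exact hx.2 hx'.2
    · intro x hx y hy hxy
      rw [Finset.mem_filter] at hx
      simp only [Finset.mem_insert, Finset.mem_union, Finset.mem_filter] at hy
      rcases hy with rfl | hy | hy
      · exact hx.2 hxy.symm
      · exact hno x hx.1 y hy hxy
      · exact hP hxy hy.2.symm htb (fun h => hx.2 h.symm) (hno x hx.1 b hb) (hno y hy.1 b hb)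
  have := hmax _ _ hsep
  rw [Finset.card_insert_of_notMem, Finset.card_union_of_disjoint] at this
  · have h2 := Finset.card_filter_add_card_filter_not (s := A) (fun x => G.Adj t x)
    omega
  · exact Finset.disjoint_left.2 fun x hx hx' => hdis' x (Finset.mem_filter.1 hx').1 hx
  · simp [htA, htB]

theorem Connected.traceable_of_pathFourFree [Fintype V] (hG : G.Connected)
    (hheavy : G.ClawHeavy) (hP : G.PathFourFree) : G.Traceable := by
  classical
  have := hG.nonempty
  by_cases hcomplete : ∀ u v, u ≠ v → G.Adj u v
  · refine traceable_iff_exists_isPathList.2 ⟨Finset.univ.toList,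
      ⟨Finset.nodup_toList _, ?_⟩, by simp⟩
    exact (List.Pairwise.imp (fun h => hcomplete _ _ h) (Finset.nodup_toList _)).isChain
  push Not at hcomplete
  obtain ⟨u, v, huv, hnadj⟩ := hcomplete
  have hex : (Finset.univ.filter fun p : Finset V × Finset V => G.Separated p.1 p.2).Nonempty := by
    refine ⟨({u}, {v}), Finset.mem_filter.2 ⟨Finset.mem_univ _, ?_⟩⟩
    simp [Separated, huv, hnadj]
  obtain ⟨⟨A, B⟩, hAB, hmax⟩ := Finset.exists_max_image _ (fun p => p.1.card + p.2.card) hex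
  simp only [Finset.mem_filter, Finset.mem_univ, true_and, Prod.forall] at hAB hmax
  have hA : ∀ t, t ∉ A → t ∉ B → ∀ w ∈ A, G.Adj t w := fun t =>
    hP.adj_of_separated hAB hmax
  have hB : ∀ t, t ∉ B → t ∉ A → ∀ w ∈ B, G.Adj t w := fun t =>
    hP.adj_of_separated hAB.symm fun A' B' h => by
      rw [add_comm B.card]
      exact hmax A' B' h
  obtain ⟨⟨a, ha⟩, ⟨b, hb⟩, hdis, hno⟩ := hAB
  have hadj : ∀ t, t ∉ A ∪ B → ∀ w ∈ A ∪ B, G.Adj t w := by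
    intro t ht w hw
    rw [Finset.mem_union, not_or] at ht
    rcases Finset.mem_union.1 hw with h | h
    · exact hA t ht.1 ht.2 w h
    · exact hB t ht.2 ht.1 w h
  -- An edge leaving `A` cannot end in `B`, so the complement of `A ∪ B` is nonempty and `G` is a
  -- join.
  obtain ⟨x, hx, y, hy, hxy⟩ := hG.exists_boundary_adj (s := (A : Set V)) (a := a) (b := b)
    (by simpa using ha) (by simpa using Finset.disjoint_right.1 hdis hb)
  have hy' : y ∉ A ∪ B := by
    rw [Finset.mem_union, not_or]
    exact ⟨by simpa using hy, fun h => hno x (by simpa using hx) y h hxy⟩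
  by_cases hcard : 2 * (A ∪ B).card ≤ Fintype.card V
  · exact traceable_of_join hheavy ⟨a, Finset.mem_union_left _ ha⟩ hcard
      fun t ht w hw => (hadj w hw t ht).symm
  · refine traceable_of_join hheavy (T := (A ∪ B)ᶜ) ⟨y, Finset.mem_compl.2 hy'⟩ ?_
      fun t ht w hw => hadj t (Finset.mem_compl.1 ht) w (Finset.notMem_compl.1 hw)
    rw [Finset.card_compl]
    omega

end PathFour

/-! ### Paw-free and triangle-free graphs -/

section Triangle

variable {V : Type*} {G : SimpleGraph V}

/-- `G` has no induced triangle with a pendant edge. -/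
def PawFree (G : SimpleGraph V) : Prop :=
  ∀ ⦃a b c d : V⦄, G.Adj a b → G.Adj b c → G.Adj a c → G.Adj d a → d ≠ b → d ≠ c →
    G.Adj d b ∨ G.Adj d c

/-- `G` has no triangle. -/
def TriangleFree (G : SimpleGraph V) : Prop :=
  ∀ ⦃a b c : V⦄, G.Adj a b → G.Adj b c → G.Adj a c → False

/-- In a connected graph without induced paws, every vertex is adjacent to at least two vertices
of every triangle. -/
theorem Connected.adj_triangle_of_pawFree (hG : G.Connected) (hP : G.PawFree) {a b c : V}
    (hab : G.Adj a b) (hbc : G.Adj b c) (hac : G.Adj a c) (z : V) :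
    (G.Adj z a ∧ G.Adj z b) ∨ (G.Adj z a ∧ G.Adj z c) ∨ (G.Adj z b ∧ G.Adj z c) := by
  by_contra hz
  obtain ⟨x, hx, y, hy, hxy⟩ := hG.exists_boundary_adj
    (s := {z | (G.Adj z a ∧ G.Adj z b) ∨ (G.Adj z a ∧ G.Adj z c) ∨ (G.Adj z b ∧ G.Adj z c)})
    (a := a) (b := z) (Or.inr (Or.inr ⟨hab, hac⟩)) hz
  simp only [Set.mem_ofPred_eq] at hx hy
  apply hy
  have key : ∀ p q s : V, G.Adj p q → G.Adj q s → G.Adj p s → G.Adj y p →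
      (G.Adj y p ∧ G.Adj y q) ∨ (G.Adj y p ∧ G.Adj y s) ∨ (G.Adj y q ∧ G.Adj y s) := by
    intro p q s hpq hqs hps hyp
    by_cases h₁ : y = q
    · subst h₁; exact Or.inr (Or.inl ⟨hyp, hqs⟩)
    by_cases h₂ : y = s
    · subst h₂; exact Or.inl ⟨hyp, hqs.symm⟩
    have := hP hpq hqs hps hyp h₁ h₂
    tauto
  -- The property spreads along the edge `xy`: `x p q` is a triangle, so `y` is adjacent to `p` or
  -- `q`, and then `key` applies to the original triangle.
  have key' : ∀ p q s : V, G.Adj p q → G.Adj q s → G.Adj p s → G.Adj x p → G.Adj x q →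
      (G.Adj y p ∧ G.Adj y q) ∨ (G.Adj y p ∧ G.Adj y s) ∨ (G.Adj y q ∧ G.Adj y s) := by
    intro p q s hpq hqs hps hxp hxq
    by_cases h₁ : y = p
    · subst h₁; exact Or.inr (Or.inr ⟨hpq, hps⟩)
    by_cases h₂ : y = q
    · subst h₂; exact Or.inr (Or.inl ⟨hpq.symm, hqs⟩)
    rcases hP hxp hpq hxq hxy.symm h₁ h₂ with h | h
    · exact key p q s hpq hqs hps h
    · have := key q p s hpq.symm hps hqs h
      tauto
  rcases hx with ⟨h, h'⟩ | ⟨h, h'⟩ | ⟨h, h'⟩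
  · exact key' a b c hab hbc hac h h'
  · have := key' a c b hac hbc.symm hab h h'
    tauto
  · have := key' b c a hbc hac.symm hab.symm h h'
    tauto

/-- A connected graph without induced paws is triangle-free or complete multipartite. -/
theorem Connected.adj_or_adj_of_pawFree (hG : G.Connected) (hP : G.PawFree)
    (hT : ¬ G.TriangleFree) {x y : V} (hxy : G.Adj x y) (z : V) : G.Adj z x ∨ G.Adj z y := by
  unfold TriangleFree at hT
  push Not at hT
  obtain ⟨a, b, c, hab, hbc, hac, -⟩ := hT
  -- A triangle is moved until it contains the edge `xy`: first one through `x`, then one through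
  -- `x` and `y`.
  obtain ⟨p, q, hpq, hxp, hxq⟩ : ∃ p q, G.Adj p q ∧ G.Adj x p ∧ G.Adj x q := by
    rcases hG.adj_triangle_of_pawFree hP hab hbc hac x with h | h | h
    · exact ⟨a, b, hab, h⟩
    · exact ⟨a, c, hac, h⟩
    · exact ⟨b, c, hbc, h⟩
  obtain ⟨w, hxw, hyw⟩ : ∃ w, G.Adj x w ∧ G.Adj y w := by
    rcases hG.adj_triangle_of_pawFree hP hxp hpq hxq y with h | h | h
    · exact ⟨p, hxp, h.2⟩
    · exact ⟨q, hxq, h.2⟩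
    · exact ⟨q, hxq, h.2⟩
  have := hG.adj_triangle_of_pawFree hP hxy hyw hxw z
  tauto

variable [Fintype V]

open scoped Classical in
theorem TriangleFree.degree_add_degree_le (hT : G.TriangleFree) {u w : V} (huw : G.Adj u w) :
    G.degree u + G.degree w ≤ Fintype.card V := by
  rw [← card_neighborFinset_eq_degree, ← card_neighborFinset_eq_degree,
    ← Finset.card_union_of_disjoint, ← Finset.card_univ]
  · exact Finset.card_le_card (Finset.subset_univ _)
  · rw [Finset.disjoint_left]
    intro x hx hx'
    rw [mem_neighborFinset] at hx hx'
    exact hT huw hx' hx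

open scoped Classical in
theorem TriangleFree.adj_or_adj (hT : G.TriangleFree) {u w : V} (huw : G.Adj u w)
    (hd : Fintype.card V ≤ G.degree u + G.degree w) (x : V) : G.Adj u x ∨ G.Adj w x := by
  by_contra hx
  have hdis : Disjoint (G.neighborFinset u) (G.neighborFinset w) := by
    rw [Finset.disjoint_left]
    intro y hy hy'
    rw [mem_neighborFinset] at hy hy'
    exact hT huw hy' hy
  have hlt : (G.neighborFinset u ∪ G.neighborFinset w).card < Fintype.card V := by
    rw [← Finset.card_univ]
    refine Finset.card_lt_card (Finset.ssubset_univ_iff.2 fun h => hx ?_)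
    have := h ▸ Finset.mem_univ x
    simpa using this
  rw [Finset.card_union_of_disjoint hdis, card_neighborFinset_eq_degree,
    card_neighborFinset_eq_degree] at hlt
  omega

-- The disjoint sets N(u) and N(w) cover all vertices, and a neighbour of `a` lying in N(w) would
-- close a triangle.
open scoped Classical in
theorem TriangleFree.neighborFinset_subset (hT : G.TriangleFree) {u w : V} (huw : G.Adj u w)
    (hd : Fintype.card V ≤ G.degree u + G.degree w) {a : V} (ha : G.Adj w a) :
    G.neighborFinset a ⊆ G.neighborFinset u := by
  intro x hx
  rw [mem_neighborFinset] at hx ⊢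
  rcases hT.adj_or_adj huw hd x with h | h
  · exact h
  · exact (hT ha hx h).elim

open scoped Classical in
theorem TriangleFree.adj_of_degree_eq (hT : G.TriangleFree) {u w : V} (huw : G.Adj u w)
    (hd : Fintype.card V ≤ G.degree u + G.degree w) {a b : V} (ha : G.Adj w a)
    (hda : G.degree a = G.degree u) (hb : G.Adj u b) : G.Adj a b := by
  have := Finset.eq_of_subset_of_card_le (hT.neighborFinset_subset huw hd ha)
    (by simp [hda])
  rw [← mem_neighborFinset, this]
  simpa using hb

-- Neighbours of `w` have degree at most m, so a heavy pair of leaves has both degrees equal to m.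
-- Any two of the leaves `a`, `a'`, `c` include `a` or `a'`.
open scoped Classical in
theorem TriangleFree.degree_eq_or_degree_eq (hT : G.TriangleFree) (hheavy : G.ClawHeavy) {u w : V}
    (huw : G.Adj u w) {m : ℕ} (hu : G.degree u = m) (hw : G.degree w = m) (hm : 3 ≤ m)
    (hcard : Fintype.card V = 2 * m) {a a' : V} (ha : G.Adj w a) (ha' : G.Adj w a')
    (hne : a ≠ a') : G.degree a = m ∨ G.degree a' = m := by
  have hle : ∀ x, G.Adj w x → G.degree x ≤ m := fun x hx => by
    have := Finset.card_le_card (hT.neighborFinset_subset huw (by omega) hx)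
    simpa [hu] using this
  obtain ⟨c, hc⟩ : ∃ c, c ∈ (G.neighborFinset w) \ {a, a'} := by
    refine Finset.card_pos.1 ?_
    have h₁ := Finset.le_card_sdiff ({a, a'} : Finset V) (G.neighborFinset w)
    have h₂ : ({a, a'} : Finset V).card ≤ 2 := Finset.card_le_two
    rw [card_neighborFinset_eq_degree] at h₁
    omega
  simp only [Finset.mem_sdiff, mem_neighborFinset, Finset.mem_insert, Finset.mem_singleton,
    not_or] at hc
  have h₁ := hle a ha
  have h₂ := hle a' ha'
  have h₃ := hle c hc.1
  have := hheavy ha ha' hc.1 hne (Ne.symm hc.2.1) (Ne.symm hc.2.2) (fun h => hT ha h ha')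
    (fun h => hT ha h hc.1) (fun h => hT ha' h hc.1)
  omega

-- At most one neighbour of `w` has degree other than m; the others are adjacent to all of N(u), in
-- particular to `b`.
open scoped Classical in
theorem TriangleFree.le_degree (hT : G.TriangleFree) (hheavy : G.ClawHeavy) {u w : V}
    (huw : G.Adj u w) {m : ℕ} (hu : G.degree u = m) (hw : G.degree w = m) (hm : 3 ≤ m)
    (hcard : Fintype.card V = 2 * m) {b : V} (hb : G.Adj u b) : m ≤ G.degree b + 1 := by
  have h₁ : ((G.neighborFinset w).filter fun a => ¬ G.degree a = m).card ≤ 1 := by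
    rw [Finset.card_le_one]
    intro a ha a' ha'
    rw [Finset.mem_filter, mem_neighborFinset] at ha ha'
    by_contra hne
    have := hT.degree_eq_or_degree_eq hheavy huw hu hw hm hcard ha.1 ha'.1 hne
    tauto
  have h₂ : ((G.neighborFinset w).filter fun a => G.degree a = m).card ≤ G.degree b := by
    rw [← card_neighborFinset_eq_degree]
    refine Finset.card_le_card fun a ha => ?_
    rw [Finset.mem_filter, mem_neighborFinset] at ha
    rw [mem_neighborFinset]
    exact (hT.adj_of_degree_eq huw (by omega) ha.1 (by omega) hb).symm
  have h₃ := Finset.card_filter_add_card_filter_not (s := G.neighborFinset w)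
    (fun a => G.degree a = m)
  rw [card_neighborFinset_eq_degree] at h₃
  omega

open scoped Classical in
theorem TriangleFree.traceable_of_adj (hT : G.TriangleFree) (hheavy : G.ClawHeavy) {u w : V}
    (huw : G.Adj u w) (hu : Fintype.card V ≤ 2 * G.degree u)
    (hw : Fintype.card V ≤ 2 * G.degree w) (hm : 3 ≤ G.degree u) : G.Traceable := by
  by_contra hnt
  obtain ⟨H, hGH, hH⟩ := exists_maximal_not_traceable hnt
  have hle := hT.degree_add_degree_le huw
  have hwu : G.degree w = G.degree u := by omega
  have hcard : Fintype.card V = 2 * G.degree u := by omega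
  -- Two vertices of one class have degrees at least m and m - 1, just enough for adjacency in `H`.
  have side : ∀ {x y a a' : V}, G.Adj x y → G.degree x = G.degree u → G.degree y = G.degree u →
      G.Adj y a → G.Adj y a' → a ≠ a' → H.Adj a a' := by
    intro x y a a' hxy hx hy ha ha' hne
    refine adj_of_maximal hGH hH hne ?_
    have h₁ := hT.degree_eq_or_degree_eq hheavy hxy hx hy hm hcard ha ha' hne
    have h₂ := hT.le_degree hheavy hxy.symm hy hx hm hcard ha
    have h₃ := hT.le_degree hheavy hxy.symm hy hx hm hcard ha'
    omega
  have hor := hT.adj_or_adj huw (by omega)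
  have huniv : ∀ x, x ≠ u → H.Adj u x := by
    intro x hx
    rcases hor x with h | h
    · exact hGH h
    · exact side huw rfl hwu huw.symm h hx.symm
  obtain ⟨a, b, c, hab, hac, hbc, nab, nac, nbc⟩ :=
    exists_three_nonadj_of_not_traceable hH.1 huniv
  have s₁ := fun {a a'} => @side u w a a' huw rfl hwu
  have s₂ := fun {a a'} => @side w u a a' huw.symm hwu rfl
  rcases hor a with ha | ha <;> rcases hor b with hb | hb <;> rcases hor c with hc | hc
  · exact nab (s₂ ha hb hab)
  · exact nab (s₂ ha hb hab)
  · exact nac (s₂ ha hc hac)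
  · exact nbc (s₁ hb hc hbc)
  · exact nbc (s₂ hb hc hbc)
  · exact nac (s₁ ha hc hac)
  · exact nab (s₁ ha hb hab)
  · exact nab (s₁ ha hb hab)

-- A longest path misses a vertex, so some vertex on it has a neighbour off it besides its
-- predecessor and successor.
open scoped Classical in
theorem Connected.exists_three_le_degree (hG : G.Connected) (hnt : ¬ G.Traceable) :
    ∃ v, 3 ≤ G.degree v := by
  have := hG.nonempty
  obtain ⟨l, hl⟩ := G.exists_isLongestPathList
  obtain ⟨z, hz⟩ : ∃ z, z ∉ l := by
    by_contra! h
    exact hnt (traceable_iff_exists_isPathList.2 ⟨l, hl.1, h⟩)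
  obtain ⟨y, hy⟩ : ∃ y, y ∈ l := by
    refine List.exists_mem_of_ne_nil _ ?_
    rintro rfl
    exact hl.not_isPathList_of_length_lt (l' := [z]) (by simp)
      ⟨List.nodup_singleton _, List.isChain_singleton _⟩
  obtain ⟨v, hv, x, hx, hvx⟩ := hG.exists_boundary_adj (s := {w | w ∈ l}) hy hz
  simp only [Set.mem_ofPred_eq] at hv hx
  obtain ⟨a, l₁, s, l₂, rfl, -⟩ := hl.exists_of_adj hv hx hvx
  obtain ⟨hn, hc⟩ := hl.1
  obtain ⟨l₃, p, hp⟩ : ∃ l₃ p, a :: l₁ = l₃ ++ [p] :=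
    ⟨_, _, (List.dropLast_append_getLast (List.cons_ne_nil a l₁)).symm⟩
  rw [hp] at hn hc hx
  rw [List.isChain_append] at hc
  have hpv : G.Adj p v := hc.2.2 p (by simp) v (by simp)
  have hvs : G.Adj v s := (List.isChain_cons_cons.1 hc.2.1).1
  have hps : p ≠ s := by
    rintro rfl
    exact List.disjoint_of_nodup_append hn (a := p) (by simp) (by simp)
  have hxp : x ≠ p := by rintro rfl; simp at hx
  have hxs : x ≠ s := by rintro rfl; simp at hx
  refine ⟨v, ?_⟩
  have hsub : ({p, s, x} : Finset V) ⊆ G.neighborFinset v := by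
    intro w hw
    simp only [Finset.mem_insert, Finset.mem_singleton] at hw
    rw [mem_neighborFinset]
    rcases hw with rfl | rfl | rfl
    exacts [hpv.symm, hvs, hvx]
  have := Finset.card_le_card hsub
  rwa [Finset.card_eq_three.2 ⟨p, s, x, hps, hxp.symm, hxs.symm, rfl⟩,
    card_neighborFinset_eq_degree] at this

open scoped Classical in
theorem TriangleFree.exists_adj_le_degree (hT : G.TriangleFree) (hheavy : G.ClawHeavy) {v : V}
    (hv : 3 ≤ G.degree v) : ∃ u, G.Adj v u ∧ Fintype.card V ≤ 2 * G.degree u := by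
  rw [← card_neighborFinset_eq_degree] at hv
  obtain ⟨t, ht, hc⟩ := Finset.exists_subset_card_eq hv
  obtain ⟨x, y, z, hxy, hxz, hyz, rfl⟩ := Finset.card_eq_three.1 hc
  have hx : G.Adj v x := by simpa using ht (by simp : x ∈ ({x, y, z} : Finset V))
  have hy : G.Adj v y := by simpa using ht (by simp : y ∈ ({x, y, z} : Finset V))
  have hz : G.Adj v z := by simpa using ht (by simp : z ∈ ({x, y, z} : Finset V))
  have := hheavy hx hy hz hxy hxz hyz (fun h => hT hx h hy) (fun h => hT hx h hz)
    (fun h => hT hy h hz)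
  by_contra! hcon
  have h₁ := hcon x hx
  have h₂ := hcon y hy
  have h₃ := hcon z hz
  omega

theorem Connected.traceable_of_triangleFree (hG : G.Connected) (hheavy : G.ClawHeavy)
    (hT : G.TriangleFree) : G.Traceable := by
  classical
  by_contra hnt
  obtain ⟨v, hv⟩ := hG.exists_three_le_degree hnt
  obtain ⟨u, hvu, hu⟩ := hT.exists_adj_le_degree hheavy hv
  have hu3 : 3 ≤ G.degree u := by
    have := hT.degree_add_degree_le hvu
    omega
  obtain ⟨w, huw, hw⟩ := hT.exists_adj_le_degree hheavy hu3
  exact hnt (hT.traceable_of_adj hheavy huw hu hw hu3)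

theorem Connected.traceable_of_pawFree (hG : G.Connected) (hheavy : G.ClawHeavy)
    (hP : G.PawFree) : G.Traceable := by
  by_cases hT : G.TriangleFree
  · exact hG.traceable_of_triangleFree hheavy hT
  · refine hG.traceable_of_pathFourFree hheavy fun a b c d hab _ _ _ had hbd => ?_
    rcases hG.adj_or_adj_of_pawFree hP hT hab d with h | h
    · exact had h.symm
    · exact hbd h.symm

end Triangle

/-! ### Explicit forms of the forbidden subgraphs -/

section Forbidden

variable {V W : Type*} {G : SimpleGraph V} {S : SimpleGraph W}

theorem graphZ1_adj {i j : Fin 4} : graphZ1.Adj i j ↔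
    i ≠ j ∧ (s(i, j) = s(0, 1) ∨ s(i, j) = s(1, 2) ∨ s(i, j) = s(0, 2) ∨ s(i, j) = s(0, 3)) := by
  simp [graphZ1, and_comm]

theorem InducedFree.of_iso {V' : Type*} {H : SimpleGraph V'} (h : S.InducedFree G)
    (e : S ≃g H) : H.InducedFree G :=
  fun ⟨f⟩ => h ⟨f.comp e.toEmbedding⟩

theorem triangleFree_of_inducedFree (h : (cycleGraph 3).InducedFree G) : G.TriangleFree := by
  intro a b c hab hbc hac
  have h1 := hab.ne; have h2 := hbc.ne; have h3 := hac.ne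
  have h4 := hab.symm; have h5 := hbc.symm; have h6 := hac.symm
  refine h ⟨⟨⟨![a, b, c], ?_⟩, ?_⟩⟩
  · intro i j hij
    fin_cases i <;> fin_cases j <;> simp_all
  · intro i j
    change G.Adj (![a, b, c] i) (![a, b, c] j) ↔ _
    rw [cycleGraph_three_eq_top]
    fin_cases i <;> fin_cases j <;> simp_all

theorem pawFree_of_inducedFree (h : graphZ1.InducedFree G) : G.PawFree := by
  intro a b c d hab hbc hac hda hdb hdc
  by_contra! hd
  obtain ⟨ndb, ndc⟩ := hd
  have h1 := hab.ne; have h2 := hbc.ne; have h3 := hac.ne; have h0 := hda.ne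
  have h4 := hab.symm; have h5 := hbc.symm; have h6 := hac.symm; have h7 := hda.symm
  have h8 : ¬ G.Adj b d := fun h => ndb h.symm
  have h9 : ¬ G.Adj c d := fun h => ndc h.symm
  refine h ⟨⟨⟨![a, b, c, d], ?_⟩, ?_⟩⟩
  · intro i j hij
    fin_cases i <;> fin_cases j <;> simp_all
  · intro i j
    change G.Adj (![a, b, c, d] i) (![a, b, c, d] j) ↔ _
    rw [graphZ1_adj]
    fin_cases i <;> fin_cases j <;> simp_all

theorem pathFourFree_of_inducedFree (h : (pathGraph 4).InducedFree G) : G.PathFourFree := by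
  intro a b c d hab hbc hcd nac nad nbd
  have h1 := hab.ne; have h2 := hbc.ne; have h3 := hcd.ne
  have h4 := hab.symm; have h5 := hbc.symm; have h6 := hcd.symm
  have h7 : ¬ G.Adj c a := fun h => nac h.symm
  have h8 : ¬ G.Adj d a := fun h => nad h.symm
  have h9 : ¬ G.Adj d b := fun h => nbd h.symm
  have hac : a ≠ c := by rintro rfl; exact nad hcd
  have had : a ≠ d := by rintro rfl; exact nac hcd.symm
  have hbd : b ≠ d := by rintro rfl; exact nad hab
  refine h ⟨⟨⟨![a, b, c, d], ?_⟩, ?_⟩⟩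
  · intro i j hij
    fin_cases i <;> fin_cases j <;> simp_all
  · intro i j
    change G.Adj (![a, b, c, d] i) (![a, b, c, d] j) ↔ _
    rw [pathGraph_adj]
    fin_cases i <;> fin_cases j <;> simp_all

end Forbidden

/-! ### Invariance under isomorphism and criteria for the examples -/

section Transfer

variable {V V' : Type*} {G : SimpleGraph V} {G' : SimpleGraph V'}

theorem Traceable.of_iso [Nonempty V] (h : G.Traceable) (e : G ≃g G') : G'.Traceable := by
  have : Nonempty V' := Nonempty.map e inferInstance
  obtain ⟨l, ⟨hn, hc⟩, hl⟩ := traceable_iff_exists_isPathList.1 h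
  refine traceable_iff_exists_isPathList.2 ⟨l.map e, ⟨hn.map e.injective, ?_⟩, fun v => ?_⟩
  · rw [List.isChain_map]
    exact hc.imp fun _ _ h => e.map_adj_iff.2 h
  · exact List.mem_map.2 ⟨e.symm v, hl _, e.apply_symm_apply v⟩

theorem IsOHeavy.of_iso {W : Type*} {H : SimpleGraph W} [Fintype V] [Fintype V'] {r : ℤ}
    (h : H.IsOHeavy r G) (e : G ≃g G') : H.IsOHeavy r G' := by
  classical
  rintro X ⟨i⟩
  let f : H ↪g G := e.symm.toEmbedding.comp ((Embedding.induce X).comp i.toEmbedding)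
  have hf : ∀ w, e (f w) ∈ X := fun w => by simp [f]
  obtain ⟨_, ⟨u, rfl⟩, _, ⟨v, rfl⟩, hne, hna, hd⟩ := h _ f.nonempty_iso_induce_range
  refine ⟨e (f u), hf u, e (f v), hf v, e.injective.ne hne, mt e.map_adj_iff.1 hna, ?_⟩
  rw [← Fintype.card_congr e.toEquiv, e.degree_eq, e.degree_eq]
  convert hd

open scoped Classical in
theorem isOHeavy_claw_of_forall [Fintype V] {r : ℤ}
    (h : ∀ c x y z, G.Adj c x → G.Adj c y → G.Adj c z → x ≠ y → x ≠ z → y ≠ z →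
      ¬ G.Adj x y → ¬ G.Adj x z → ¬ G.Adj y z →
      (Fintype.card V : ℤ) + r ≤ G.degree x + G.degree y) : clawGraph.IsOHeavy r G := by
  rintro X ⟨i⟩
  let f : clawGraph ↪g G := (Embedding.induce X).comp i.toEmbedding
  have hf : ∀ w, f w ∈ X := fun w => by simp [f]
  have hc : ∀ j, G.Adj (f (.inl 0)) (f (.inr j)) := fun j => f.map_adj_iff.2 (by simp)
  have hn : ∀ j k, ¬ G.Adj (f (.inr j)) (f (.inr k)) := fun j k => mt f.map_adj_iff.1 (by simp)
  have hne : ∀ j k, j ≠ k → f (.inr j) ≠ f (.inr k) := fun j k hjk =>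
    f.injective.ne (by simpa using hjk)
  refine ⟨f (.inr 0), hf _, f (.inr 1), hf _, hne 0 1 (by decide), hn 0 1, ?_⟩
  exact h _ _ _ _ (hc 0) (hc 1) (hc 2) (hne 0 1 (by decide)) (hne 0 2 (by decide))
    (hne 1 2 (by decide)) (hn 0 1) (hn 0 2) (hn 1 2)

/-- A graph with three vertices of degree at most one is not traceable. -/
theorem not_traceable_of_three_leaves {x p : Fin 3 → V} (hx : Function.Injective x)
    (h : ∀ i w, G.Adj (x i) w → w = p i) : ¬ G.Traceable := by
  have : Nonempty V := ⟨x 0⟩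
  rw [traceable_iff_exists_isPathList]
  rintro ⟨l, ⟨hn, hc⟩, hl⟩
  -- A leaf inside the path would have its only neighbour on both sides. Three leaves cannot share
  -- two ends.
  have key : ∀ i, l.head? = some (x i) ∨ l.getLast? = some (x i) := by
    intro i
    obtain ⟨l₁, l₂, rfl⟩ := List.append_of_mem (hl (x i))
    rcases l₁.eq_nil_or_concat with rfl | ⟨l₁, a, rfl⟩
    · simp
    rcases l₂ with _ | ⟨b, l₂⟩
    · right; rw [List.getLast?_concat]
    exfalso
    rw [List.isChain_append, List.isChain_cons_cons] at hc
    have ha : a = p i := h i a (hc.2.2 a (by simp) (x i) (by simp)).symm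
    have hb : b = p i := h i b hc.2.1.1
    exact List.disjoint_of_nodup_append hn (a := p i) (by simp [ha]) (by simp [hb])
  have ne : ∀ {i j} {o : Option V}, o = some (x i) → o = some (x j) → i = j :=
    fun hi hj => hx (Option.some_injective _ (hi.symm.trans hj))
  rcases key 0 with h0 | h0 <;> rcases key 1 with h1 | h1 <;> rcases key 2 with h2 | h2 <;>
    first
    | exact absurd (ne h0 h1) (by decide)
    | exact absurd (ne h0 h2) (by decide)
    | exact absurd (ne h1 h2) (by decide)

end Transfer

/-! ### The net and its induced subgraphs -/

section Net

/-- The net: a triangle `0, 1, 2` with a pendant edge joining `i + 3` to each `i`. -/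
def netGraph : SimpleGraph (Fin 6) where
  Adj i j := i ≠ j ∧ ((i.val < 3 ∧ j.val < 3) ∨ i.val + 3 = j.val ∨ j.val + 3 = i.val)
  symm := ⟨fun i j h => ⟨h.1.symm, by tauto⟩⟩
  loopless := ⟨fun i h => h.1 rfl⟩

instance : DecidableRel netGraph.Adj := fun i j =>
  inferInstanceAs (Decidable (i ≠ j ∧ ((i.val < 3 ∧ j.val < 3) ∨ i.val + 3 = j.val ∨
    j.val + 3 = i.val)))

theorem netGraph_connected : netGraph.Connected := by
  have h : ∀ i : Fin 6, netGraph.Reachable i 0 := by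
    have h1 : netGraph.Adj 1 0 := by decide
    have h2 : netGraph.Adj 2 0 := by decide
    have h3 : netGraph.Adj 3 0 := by decide
    have h4 : netGraph.Adj 4 1 := by decide
    have h5 : netGraph.Adj 5 2 := by decide
    intro i
    fin_cases i
    exacts [Reachable.refl _, h1.reachable, h2.reachable, h3.reachable,
      h4.reachable.trans h1.reachable, h5.reachable.trans h2.reachable]
  exact ⟨fun i j => (h i).trans (h j).symm⟩

theorem netGraph_not_traceable : ¬ netGraph.Traceable :=
  not_traceable_of_three_leaves (x := ![3, 4, 5]) (p := ![0, 1, 2]) (by decide) (by decide)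

-- Vacuous: the net has no induced claw.
set_option maxRecDepth 10000 in
theorem netGraph_isOHeavy (r : ℤ) : clawGraph.IsOHeavy r netGraph := by
  apply isOHeavy_claw_of_forall
  intro c x y z h₁ h₂ h₃ h₄ h₅ h₆ h₇ h₈ h₉
  exfalso
  revert c x y z
  decide

-- Excluding isolated vertices suffices for connectedness here: a chosen pendant vertex forces its
-- triangle vertex, and triangle vertices are pairwise adjacent. The first alternative collects the
-- sets containing a bull.
set_option maxRecDepth 10000 in
theorem netGraph_classification : ∀ X : Finset (Fin 6), 3 ≤ X.card →
    (∀ i ∈ X, ∃ j ∈ X, netGraph.Adj i j) →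
    ({0, 1, 2, 3, 4} ⊆ X ∨ {0, 1, 2, 3, 5} ⊆ X ∨ {0, 1, 2, 4, 5} ⊆ X) ∨
    (X = Finset.univ.image ![3, 0, 1] ∨ X = Finset.univ.image ![3, 0, 2] ∨
      X = Finset.univ.image ![4, 1, 0] ∨ X = Finset.univ.image ![4, 1, 2] ∨
      X = Finset.univ.image ![5, 2, 0] ∨ X = Finset.univ.image ![5, 2, 1]) ∨
    X = Finset.univ.image ![0, 1, 2] ∨
    (X = Finset.univ.image ![0, 1, 2, 3] ∨ X = Finset.univ.image ![1, 0, 2, 4] ∨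
      X = Finset.univ.image ![2, 0, 1, 5]) ∨
    (X = Finset.univ.image ![3, 0, 1, 4] ∨ X = Finset.univ.image ![3, 0, 2, 5] ∨
      X = Finset.univ.image ![4, 1, 2, 5]) := by
  decide

variable {W : Type*} [Fintype W] {S : SimpleGraph W}

theorem Embedding.nonempty_iso_of_image_eq {V : Type*} [DecidableEq V] {G : SimpleGraph V} {k : ℕ}
    {H : SimpleGraph (Fin k)} (f : S ↪g G) (t : Fin k → V) (ht : Function.Injective t)
    (hadj : ∀ i j, G.Adj (t i) (t j) ↔ H.Adj i j)
    (h : Finset.univ.image f = Finset.univ.image t) : Nonempty (S ≃g H) := by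
  refine f.nonempty_iso_of_range_eq (⟨⟨t, ht⟩, fun {i j} => hadj i j⟩ : H ↪g G) ?_
  have := congrArg (fun s : Finset V => (s : Set V)) h
  simpa using this

end Net

/-! ### The clique with three pendant paths -/

section CliquePendants

/-- The join of a complete graph on `m` vertices and three isolated vertices, with a pendant
edge attached at each of the latter. -/
def cliquePendants (m : ℕ) : SimpleGraph (Fin m ⊕ Fin 3 ⊕ Fin 3) where
  Adj
    | .inl i, .inl j => i ≠ j
    | .inl _, .inr (.inl _) => True
    | .inr (.inl _), .inl _ => True
    | .inr (.inl i), .inr (.inr j) => i = j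
    | .inr (.inr i), .inr (.inl j) => i = j
    | _, _ => False
  symm := ⟨by rintro (i | i | i) (j | j | j) <;> simp [eq_comm]⟩
  loopless := ⟨by rintro (i | i | i) <;> simp⟩

variable {m : ℕ}

@[simp] theorem cliquePendants_adj_ll {i j : Fin m} :
    (cliquePendants m).Adj (.inl i) (.inl j) ↔ i ≠ j := Iff.rfl
@[simp] theorem cliquePendants_adj_lm {i : Fin m} {j : Fin 3} :
    (cliquePendants m).Adj (.inl i) (.inr (.inl j)) ↔ True := Iff.rfl
@[simp] theorem cliquePendants_adj_ml {i : Fin m} {j : Fin 3} :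
    (cliquePendants m).Adj (.inr (.inl j)) (.inl i) ↔ True := Iff.rfl
@[simp] theorem cliquePendants_adj_mr {i j : Fin 3} :
    (cliquePendants m).Adj (.inr (.inl i)) (.inr (.inr j)) ↔ i = j := Iff.rfl
@[simp] theorem cliquePendants_adj_rm {i j : Fin 3} :
    (cliquePendants m).Adj (.inr (.inr i)) (.inr (.inl j)) ↔ i = j := Iff.rfl
@[simp] theorem cliquePendants_adj_lr {i : Fin m} {j : Fin 3} :
    (cliquePendants m).Adj (.inl i) (.inr (.inr j)) ↔ False := Iff.rfl
@[simp] theorem cliquePendants_adj_rl {i : Fin m} {j : Fin 3} :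
    (cliquePendants m).Adj (.inr (.inr j)) (.inl i) ↔ False := Iff.rfl
@[simp] theorem cliquePendants_adj_mm {i j : Fin 3} :
    (cliquePendants m).Adj (.inr (.inl i)) (.inr (.inl j)) ↔ False := Iff.rfl
@[simp] theorem cliquePendants_adj_rr {i j : Fin 3} :
    (cliquePendants m).Adj (.inr (.inr i)) (.inr (.inr j)) ↔ False := Iff.rfl

theorem cliquePendants_connected (hm : 0 < m) : (cliquePendants m).Connected := by
  have hmid : ∀ j, (cliquePendants m).Reachable (.inr (.inl j)) (.inl ⟨0, hm⟩) := fun j =>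
    Adj.reachable (by simp)
  have h : ∀ v, (cliquePendants m).Reachable v (.inl ⟨0, hm⟩) := by
    rintro (i | j | j)
    · exact (Adj.reachable (v := .inr (.inl 0)) (by simp)).trans (hmid 0)
    · exact hmid j
    · exact (Adj.reachable (v := .inr (.inl j)) (by simp)).trans (hmid j)
  have : Nonempty (Fin m ⊕ Fin 3 ⊕ Fin 3) := ⟨.inr (.inl 0)⟩
  exact ⟨fun i j => (h i).trans (h j).symm⟩

theorem cliquePendants_not_traceable : ¬ (cliquePendants m).Traceable := by
  refine not_traceable_of_three_leaves (x := fun i => .inr (.inr i))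
    (p := fun i => .inr (.inl i)) (fun i j h => by simpa using h) ?_
  rintro i (j | j | j) <;> simp [eq_comm]

theorem cliquePendants_isOHeavy {r : ℤ} (hm : 6 + r ≤ m) :
    clawGraph.IsOHeavy r (cliquePendants m) := by
  classical
  have hdeg : ∀ j, m ≤ (cliquePendants m).degree (.inr (.inl j)) := by
    intro j
    have hsub : Finset.univ.image (Sum.inl : Fin m → Fin m ⊕ Fin 3 ⊕ Fin 3) ⊆
        (cliquePendants m).neighborFinset (.inr (.inl j)) := by
      intro w hw
      obtain ⟨i, -, rfl⟩ := Finset.mem_image.1 hw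
      simp
    have := Finset.card_le_card hsub
    rwa [Finset.card_image_of_injective _ Sum.inl_injective, Finset.card_univ, Fintype.card_fin,
      card_neighborFinset_eq_degree] at this
  apply isOHeavy_claw_of_forall
  intro c x y z h₁ h₂ h₃ h₄ h₅ h₆ h₇ h₈ h₉
  -- Every claw has its centre in the clique and the three middle vertices as leaves, each of degree
  -- at least m, while n = m + 6.
  obtain ⟨i, rfl, j, rfl⟩ : ∃ i, x = .inr (.inl i) ∧ ∃ j, y = .inr (.inl j) := by
    rcases x with x | x | x <;> rcases y with y | y | y <;>
      rcases c with c | c | c <;> rcases z with z | z | z <;> simp_all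
  have h₁ := hdeg i
  have h₂ := hdeg j
  simp only [Fintype.card_sum, Fintype.card_fin]
  push_cast
  zify at h₁ h₂
  convert (by linarith : (m : ℤ) + 6 + r ≤ (cliquePendants m).degree (.inr (.inl i)) +
    (cliquePendants m).degree (.inr (.inl j)))

/-- If `a` were in the clique, `b`, `c`, `d` would be clique or middle vertices; these induce a
complete multipartite graph, where `d` cannot miss both ends of the edge `bc`. -/
theorem cliquePendants_exists_inr {a b c d : Fin m ⊕ Fin 3 ⊕ Fin 3}
    (hab : (cliquePendants m).Adj a b) (hbc : (cliquePendants m).Adj b c)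
    (hac : (cliquePendants m).Adj a c) (hda : (cliquePendants m).Adj d a)
    (hdb : ¬ (cliquePendants m).Adj d b) (hdc : ¬ (cliquePendants m).Adj d c) :
    ∃ i, a = .inr i := by
  rcases a with a | a
  · exfalso
    have hpend : ∀ {v}, (cliquePendants m).Adj v (.inl a) →
        (∃ k, v = .inl k) ∨ ∃ k, v = .inr (.inl k) := by
      rintro (k | k | k) hk
      exacts [.inl ⟨k, rfl⟩, .inr ⟨k, rfl⟩, hk.elim]
    rcases hpend hab.symm with ⟨b, rfl⟩ | ⟨b, rfl⟩ <;>
      rcases hpend hac.symm with ⟨c, rfl⟩ | ⟨c, rfl⟩ <;>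
      rcases hpend hda with ⟨d, rfl⟩ | ⟨d, rfl⟩ <;>
      simp only [cliquePendants_adj_ll, cliquePendants_adj_lm, cliquePendants_adj_ml,
        cliquePendants_adj_mm, not_true_eq_false, not_not] at hbc hdb hdc
    exact hbc (hdb.symm.trans hdc)
  · exact ⟨a, rfl⟩

/-- The graph `cliquePendants m` contains no induced bull. -/
theorem cliquePendants_bullFree {a b c d e : Fin m ⊕ Fin 3 ⊕ Fin 3}
    (hab : (cliquePendants m).Adj a b) (hbc : (cliquePendants m).Adj b c)
    (hac : (cliquePendants m).Adj a c) (hda : (cliquePendants m).Adj d a)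
    (hdb : ¬ (cliquePendants m).Adj d b) (hdc : ¬ (cliquePendants m).Adj d c)
    (heb : (cliquePendants m).Adj e b) (hea : ¬ (cliquePendants m).Adj e a)
    (hec : ¬ (cliquePendants m).Adj e c) : False := by
  obtain ⟨i, rfl⟩ := cliquePendants_exists_inr hab hbc hac hda hdb hdc
  obtain ⟨j, rfl⟩ := cliquePendants_exists_inr hab.symm hac hbc heb hea hec
  clear hda hdb hdc heb hea hec
  rcases i with i | i <;> rcases j with j | j <;> rcases c with c | c | c <;>
    first
    | exact hab
    | exact hbc
    | exact hac

end CliquePendants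

/-! ### Necessity: subgraphs common to both examples -/

section Necessity

variable {W : Type*} {S : SimpleGraph W}

theorem not_bull_subset_image [Fintype W] {m : ℕ} (f : S ↪g netGraph) (g : S ↪g cliquePendants m)
    {a b c d e : Fin 6} (hsub : {a, b, c, d, e} ⊆ Finset.univ.image f)
    (h : netGraph.Adj a b ∧ netGraph.Adj b c ∧ netGraph.Adj a c ∧ netGraph.Adj d a ∧
      ¬ netGraph.Adj d b ∧ ¬ netGraph.Adj d c ∧ netGraph.Adj e b ∧ ¬ netGraph.Adj e a ∧
      ¬ netGraph.Adj e c) : False := by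
  have hpre : ∀ x ∈ ({a, b, c, d, e} : Finset (Fin 6)), ∃ w, f w = x := fun x hx => by
    simpa using hsub hx
  obtain ⟨a, rfl⟩ := hpre a (by simp)
  obtain ⟨b, rfl⟩ := hpre b (by simp)
  obtain ⟨c, rfl⟩ := hpre c (by simp)
  obtain ⟨d, rfl⟩ := hpre d (by simp)
  obtain ⟨e, rfl⟩ := hpre e (by simp)
  -- The bull is pulled back to `S` along `f` and pushed into the bull-free graph along `g`.
  simp only [f.map_adj_iff] at h
  simp only [← g.map_adj_iff] at h
  obtain ⟨h₁, h₂, h₃, h₄, h₅, h₆, h₇, h₈, h₉⟩ := h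
  exact cliquePendants_bullFree h₁ h₂ h₃ h₄ h₅ h₆ h₇ h₈ h₉

theorem Connected.iso_of_embeddings [Fintype W] (hconn : S.Connected)
    (hcard : 3 ≤ Fintype.card W) {m : ℕ} (f : S ↪g netGraph) (g : S ↪g cliquePendants m) :
    Nonempty (S ≃g pathGraph 3) ∨ Nonempty (S ≃g cycleGraph 3) ∨ Nonempty (S ≃g graphZ1) ∨
      Nonempty (S ≃g pathGraph 4) := by
  have hX : 3 ≤ (Finset.univ.image f).card := by
    rwa [Finset.card_image_of_injective _ f.injective, Finset.card_univ]
  have hadj : ∀ i ∈ Finset.univ.image f, ∃ j ∈ Finset.univ.image f, netGraph.Adj i j := by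
    intro i hi
    obtain ⟨w, -, rfl⟩ := Finset.mem_image.1 hi
    have : Nontrivial W := Fintype.one_lt_card_iff_nontrivial.1 (by omega)
    obtain ⟨w', hw'⟩ := exists_ne w
    obtain ⟨x, rfl, y, -, hxy⟩ := hconn.exists_boundary_adj (s := {w}) rfl hw'
    exact ⟨f y, by simp, f.map_adj_iff.2 hxy⟩
  rcases netGraph_classification _ hX hadj with h | h | h | h | h
  · exfalso
    rcases h with h | h | h
    · exact not_bull_subset_image f g h (by decide)
    · refine not_bull_subset_image f g (a := 0) (b := 2) (c := 1) (d := 3) (e := 5)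
        (Finset.Subset.trans (by decide) h) (by decide)
    · refine not_bull_subset_image f g (a := 1) (b := 2) (c := 0) (d := 4) (e := 5)
        (Finset.Subset.trans (by decide) h) (by decide)
  · left
    rcases h with h | h | h | h | h | h <;>
      exact f.nonempty_iso_of_image_eq _ (by decide) (by simp only [pathGraph_adj]; decide) h
  · right; left
    exact f.nonempty_iso_of_image_eq _ (by decide)
      (by simp only [cycleGraph_three_eq_top, top_adj]; decide) h
  · right; right; left
    rcases h with h | h | h <;>
      exact f.nonempty_iso_of_image_eq _ (by decide) (by simp only [graphZ1_adj]; decide) h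
  · right; right; right
    rcases h with h | h | h <;>
      exact f.nonempty_iso_of_image_eq _ (by decide) (by simp only [pathGraph_adj]; decide) h

/-- If all connected claw-heavy `S`-free graphs in some universe are traceable, then every
nontraceable connected claw-heavy graph contains `S`. -/
theorem exists_embedding_of_not_traceable {r : ℤ} {V₀ : Type} [Fintype V₀] {G : SimpleGraph V₀}
    (h : ∀ (V : Type*) [Fintype V] (G : SimpleGraph V), G.Connected →
      clawGraph.IsOHeavy r G → S.InducedFree G → G.Traceable)
    (hconn : G.Connected) (hheavy : clawGraph.IsOHeavy r G) (hnt : ¬ G.Traceable) :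
    Nonempty (S ↪g G) := by
  -- The examples live in `Type`; lifting moves them to the universe of the hypothesis.
  let e : G.comap Equiv.ulift ≃g G := Iso.comap Equiv.ulift G
  have := hconn.nonempty
  by_contra hS
  refine hnt ((h (ULift V₀) (G.comap Equiv.ulift) (e.connected_iff.2 hconn)
    (hheavy.of_iso e.symm) ?_).of_iso e)
  rintro ⟨f⟩
  exact hS ⟨e.toEmbedding.comp f⟩

end Necessity

end SimpleGraph

theorem theorem11 (r : ℤ) (hr : 0 ≤ r) {W : Type*} [Fintype W] (S : SimpleGraph W)
    (hconn : S.Connected) (hcard : 3 ≤ Fintype.card W)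
    (hP3 : ¬ Nonempty (S ≃g SimpleGraph.pathGraph 3)) :
    (∀ (V : Type*) [Fintype V] (G : SimpleGraph V), G.Connected →
        clawGraph.IsOHeavy r G → S.InducedFree G → G.Traceable) ↔
      (Nonempty (S ≃g SimpleGraph.cycleGraph 3) ∨ Nonempty (S ≃g graphZ1) ∨
        Nonempty (S ≃g SimpleGraph.pathGraph 4)) := by
  constructor
  · intro h
    obtain ⟨f⟩ := SimpleGraph.exists_embedding_of_not_traceable h SimpleGraph.netGraph_connected
      (SimpleGraph.netGraph_isOHeavy r) SimpleGraph.netGraph_not_traceable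
    obtain ⟨g⟩ := SimpleGraph.exists_embedding_of_not_traceable h
      -- The choice of m gives 2m ≥ (m + 6) + r, as heaviness requires.
      (SimpleGraph.cliquePendants_connected (m := r.toNat + 6) (by omega))
      (SimpleGraph.cliquePendants_isOHeavy (by omega)) SimpleGraph.cliquePendants_not_traceable
    exact (hconn.iso_of_embeddings hcard f g).resolve_left hP3
  · rintro (⟨⟨e⟩⟩ | ⟨⟨e⟩⟩ | ⟨⟨e⟩⟩) V _ G hG hheavy hS
    · exact hG.traceable_of_triangleFree (hheavy.clawHeavy hr)
        (SimpleGraph.triangleFree_of_inducedFree (hS.of_iso e))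
    · exact hG.traceable_of_pawFree (hheavy.clawHeavy hr)
        (SimpleGraph.pawFree_of_inducedFree (hS.of_iso e))
    · exact hG.traceable_of_pathFourFree (hheavy.clawHeavy hr)
        (SimpleGraph.pathFourFree_of_inducedFree (hS.of_iso e))
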